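/- Let $n\ge 2$ be even. The planar $n$-complex numbers are $u=x_0+h_1x_1+\cdots+h_{n-1}x_{n-1}$ with real $x_j$, with the modulus $|u|=(x_0^2+\cdots+x_{n-1}^2)^{1/2}$ and the commutative, associative, bilinear product given by $h_0=1$ and $h_jh_k=(-1)^{[(j+k)/n]}h_{j+k-n[(j+k)/n]}$ for $0\le j,k\le n-1$, where $[x]$ denotes the integer part of $x$. For $k=1,\ldots,n/2$ put $$\tilde e_k=\frac2n\sum_{p=1}^{n-1}h_p\sin\frac{\pi(2k-1)p}{n},\qquad \xi_k=\sqrt{\tfrac2n}\sum_{p=0}^{n-1}x_p\cos\frac{\pi(2k-1)p}{n},\qquad \eta_k=\sqrt{\tfrac2n}\sum_{p=0}^{n-1}x_p\sin\frac{\pi(2k-1)p}{n},$$ and let $u_{\xi_k\eta_k}=(\xi_k,\eta_k)$ be the projection of $u$ on the $(\xi_k,\eta_k)$ plane. For a closed curve $C$ in a plane and a point $M$ of the plane not on $C$, let $\mathrm{int}(M,C)=1$ if $M$ is interior to $C$, that is, if the connected component of the complement of $C$ that contains $M$ is bounded, and $\mathrm{int}(M,C)=0$ if $M$ is exterior to $C$,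 that is, if this component is unbounded. Let $\Gamma$ be a closed piecewise $C^1$ path in the space of planar $n$-complex numbers such that, for $k=1,\ldots,n/2$, the projection $\Gamma_{\xi_k\eta_k}$ of $\Gamma$ on the $(\xi_k,\eta_k)$ plane is counterclockwise, in the sense that each bounded component of its complement contains a point around which $\Gamma_{\xi_k\eta_k}$ goes exactly once counterclockwise, i.e. the azimuthal angle about that point increases in total by $2\pi$ along the curve. (If $\Gamma_{\xi_k\eta_k}$ is a simple closed curve, this says that it is positively oriented.) Then the following integrals exist and have the values stated. 1. If $u-u_0$ is invertible for all $u\in\Gamma$, then $$\oint_\Gamma\frac{du}{u-u_0}=\sum_{k=1}^{n/2}2\pi\tilde e_k\,\mathrm{int}(u_{0\xi_k\eta_k},\Gamma_{\xi_k\eta_k}).$$ 2. If $u-u_0$ is invertible for all $u\in\Gamma$, and $f$ has an absolutely convergent expansion $f(u)=\sum_{m=0}^\infty c_m(u-u_0)^m$, with $n$-complex coefficients $c_m$, that holds at $u_0$ and at every point of $\Gamma$ (in particular, if it holds at $u_0$, on $\Gamma$ and on a surface spanning $\Gamma$), then $$\oint_\Gamma\frac{f(u)\,du}{u-u_0}=2\pi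 f(u_0)\sum_{k=1}^{n/2}\tilde e_k\,\mathrm{int}(u_{0\xi_k\eta_k},\Gamma_{\xi_k\eta_k}).$$ 3. Let $(u_l)$ be a finite or infinite family of $n$-complex numbers such that $u-u_l$ is invertible for all $l$ and all $u\in\Gamma$. For each $l$ let $F_l(u)=\sum_{m\in\mathbb Z}c_{l,m}(u-u_l)^m$ be a series in positive and negative powers, with $n$-complex coefficients, that converges absolutely at every point of $\Gamma$, and put $r_l=c_{l,-1}$. If $f=\sum_lF_l$ on $\Gamma$, where for an infinite family the (unordered) sum over $l$ converges uniformly on $\Gamma$, then $$\oint_\Gamma f(u)\,du=2\pi\sum_l\sum_{k=1}^{n/2}\tilde e_k\,\mathrm{int}(u_{l\xi_k\eta_k},\Gamma_{\xi_k\eta_k})\,r_l,$$ where for an infinite family the sum over $l$ on the right-hand side converges unconditionally. -/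

import Mathlib

/-- The planar `n`-complex numbers `u = x_0 + h_1 x_1 + ⋯ + h_{n-1} x_{n-1}` with real components,
with the Euclidean modulus `|u| = (x_0² + ⋯ + x_{n-1}²)^{1/2}`. -/
def PlanarComplex (n : ℕ) : Type := EuclideanSpace ℝ (Fin n)

namespace PlanarComplex

noncomputable instance instNormedAddCommGroup (n : ℕ) : NormedAddCommGroup (PlanarComplex n) :=
  inferInstanceAs (NormedAddCommGroup (EuclideanSpace ℝ (Fin n)))

noncomputable instance instNormedSpace (n : ℕ) : NormedSpace ℝ (PlanarComplex n) :=
  inferInstanceAs (NormedSpace ℝ (EuclideanSpace ℝ (Fin n)))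

instance instFiniteDimensional (n : ℕ) : FiniteDimensional ℝ (PlanarComplex n) :=
  inferInstanceAs (FiniteDimensional ℝ (EuclideanSpace ℝ (Fin n)))

/-- The number with components `x_0, …, x_{n-1}`. -/
def ofCoord {n : ℕ} (x : Fin n → ℝ) : PlanarComplex n := WithLp.toLp 2 x

/-- The component `x_j` of `u`. -/
def coord {n : ℕ} (u : PlanarComplex n) (j : Fin n) : ℝ := WithLp.ofLp u j

@[simp] theorem coord_ofCoord {n : ℕ} (x : Fin n → ℝ) (j : Fin n) : (ofCoord x).coord j = x j := rfl

@[simp] theorem coord_zero {n : ℕ} (j : Fin n) : (0 : PlanarComplex n).coord j = 0 := rfl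

@[simp] theorem coord_add {n : ℕ} (u v : PlanarComplex n) (j : Fin n) :
    (u + v).coord j = u.coord j + v.coord j := rfl

@[simp] theorem coord_smul {n : ℕ} (r : ℝ) (u : PlanarComplex n) (j : Fin n) :
    (r • u).coord j = r * u.coord j := rfl

theorem ext_coord {n : ℕ} {u v : PlanarComplex n} (h : ∀ j, u.coord j = v.coord j) : u = v :=
  PiLp.ext h

/-- The `k`-th component of the product `h_i h_j`, as a function of `a = i + j`:
`h_i h_j = (-1)^[a/n] h_{a - n[a/n]}`. -/
def structureConst (n a : ℕ) (k : Fin n) : ℝ := if a % n = k then (-1) ^ (a / n) else 0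

/-- The product determined by bilinearity and the rule for `h_i h_j`. -/
instance instMul (n : ℕ) : Mul (PlanarComplex n) :=
  ⟨fun u v => ofCoord fun k =>
    ∑ i : Fin n, ∑ j : Fin n, structureConst n (i + j) k * (u.coord i * v.coord j)⟩

/-- The unit `1 = h_0`. -/
instance instOne (n : ℕ) : One (PlanarComplex n) :=
  ⟨ofCoord fun j => if (j : ℕ) = 0 then 1 else 0⟩

theorem coord_mul {n : ℕ} (u v : PlanarComplex n) (k : Fin n) :
    (u * v).coord k =
      ∑ i : Fin n, ∑ j : Fin n, structureConst n (i + j) k * (u.coord i * v.coord j) := rfl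

theorem coord_one {n : ℕ} (k : Fin n) :
    (1 : PlanarComplex n).coord k = if (k : ℕ) = 0 then 1 else 0 := rfl

theorem sum_structureConst {n : ℕ} (a b : ℕ) (k : Fin n) :
    ∑ i : Fin n, structureConst n a i * structureConst n (i + b) k =
      structureConst n (a + b) k := by
  have hn : 0 < n := k.pos
  rw [Finset.sum_eq_single (⟨a % n, Nat.mod_lt _ hn⟩ : Fin n)]
  · have h1 : (a % n + b) % n = (a + b) % n := Nat.mod_add_mod a n b
    have h2 : (a + b) / n = a / n + (a % n + b) / n := by
      conv_lhs => rw [← Nat.div_add_mod a n, add_assoc, Nat.mul_add_div hn]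
    simp only [structureConst, if_true, h1, h2]
    split_ifs <;> simp [pow_add]
  · intro i _ hi
    have : ¬ a % n = i := fun h => hi (Fin.ext h.symm)
    simp [structureConst, this]
  · simp

theorem mul_comm_planar {n : ℕ} (u v : PlanarComplex n) : u * v = v * u := by
  refine ext_coord fun k => ?_
  rw [coord_mul, coord_mul, Finset.sum_comm]
  refine Finset.sum_congr rfl fun i _ => Finset.sum_congr rfl fun j _ => ?_
  rw [add_comm, mul_comm (u.coord j)]

theorem coord_mul_mul {n : ℕ} (u v w : PlanarComplex n) (k : Fin n) :
    (u * v * w).coord k = ∑ p : Fin n, ∑ q : Fin n, ∑ r : Fin n,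
      structureConst n (p + q + r) k * (u.coord p * v.coord q * w.coord r) := by
  have h : ∀ p q r : Fin n, structureConst n (p + q + r) k =
      ∑ i : Fin n, structureConst n (p + q) i * structureConst n (i + r) k := fun p q r =>
    (sum_structureConst _ _ _).symm
  simp_rw [h, coord_mul, Finset.sum_mul, Finset.mul_sum]
  rw [Finset.sum_comm]
  have : ∀ r : Fin n,
      ∑ i : Fin n, ∑ p : Fin n, ∑ q : Fin n, structureConst n (i + r) k *
        (structureConst n (p + q) i * (u.coord p * v.coord q) * w.coord r) =
      ∑ p : Fin n, ∑ q : Fin n, ∑ i : Fin n, structureConst n (p + q) i *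
        structureConst n (i + r) k * (u.coord p * v.coord q * w.coord r) := by
    intro r
    rw [Finset.sum_comm]
    refine Finset.sum_congr rfl fun p _ => ?_
    rw [Finset.sum_comm]
    refine Finset.sum_congr rfl fun q _ => Finset.sum_congr rfl fun i _ => ?_
    ring
  simp_rw [this]
  rw [Finset.sum_comm]
  refine Finset.sum_congr rfl fun p _ => ?_
  rw [Finset.sum_comm]

theorem mul_assoc_planar {n : ℕ} (u v w : PlanarComplex n) : u * v * w = u * (v * w) := by
  refine ext_coord fun k => ?_
  rw [mul_comm_planar u (v * w), coord_mul_mul, coord_mul_mul, Finset.sum_comm]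
  refine Finset.sum_congr rfl fun q _ => ?_
  rw [Finset.sum_comm]
  refine Finset.sum_congr rfl fun r _ => Finset.sum_congr rfl fun p _ => ?_
  rw [show (p : ℕ) + q + r = q + r + p by ring]
  ring

theorem one_mul_planar {n : ℕ} (u : PlanarComplex n) : 1 * u = u := by
  refine ext_coord fun k => ?_
  have hn : 0 < n := k.pos
  rw [coord_mul, Finset.sum_eq_single (⟨0, hn⟩ : Fin n), Finset.sum_eq_single k]
  · simp [coord_one, structureConst, Nat.mod_eq_of_lt k.isLt, Nat.div_eq_of_lt k.isLt]
  · intro j _ hj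
    have : ¬ (j : ℕ) = k := fun h => hj (Fin.ext h)
    simp [structureConst, Nat.mod_eq_of_lt j.isLt, this]
  · simp
  · intro i _ hi
    have : ¬ (i : ℕ) = 0 := fun h => hi (Fin.ext h)
    simp [coord_one, this]
  · simp

theorem add_mul_planar {n : ℕ} (u v w : PlanarComplex n) : (u + v) * w = u * w + v * w := by
  refine ext_coord fun k => ?_
  simp only [coord_mul, coord_add, ← Finset.sum_add_distrib]
  refine Finset.sum_congr rfl fun i _ => Finset.sum_congr rfl fun j _ => ?_
  ring

theorem smul_mul_planar {n : ℕ} (r : ℝ) (u v : PlanarComplex n) : (r • u) * v = r • (u * v) := by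
  refine ext_coord fun k => ?_
  simp only [coord_mul, coord_smul, Finset.mul_sum]
  refine Finset.sum_congr rfl fun i _ => Finset.sum_congr rfl fun j _ => ?_
  ring

theorem zero_mul_planar {n : ℕ} (u : PlanarComplex n) : 0 * u = 0 := by
  refine ext_coord fun k => ?_
  simp [coord_mul]

noncomputable instance instCommRing (n : ℕ) : CommRing (PlanarComplex n) :=
  { instNormedAddCommGroup n, instMul n, instOne n with
    mul_assoc := mul_assoc_planar
    mul_comm := mul_comm_planar
    one_mul := one_mul_planar
    mul_one := fun u => by rw [mul_comm_planar, one_mul_planar]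
    zero_mul := zero_mul_planar
    mul_zero := fun u => by rw [mul_comm_planar, zero_mul_planar]
    right_distrib := add_mul_planar
    left_distrib := fun u v w => by
      rw [mul_comm_planar, add_mul_planar, mul_comm_planar v, mul_comm_planar w] }

noncomputable instance instAlgebra (n : ℕ) : Algebra ℝ (PlanarComplex n) :=
  Algebra.ofModule smul_mul_planar fun r u v => by
    rw [mul_comm_planar, smul_mul_planar, mul_comm_planar]

/-- The element `ẽ_k = (2/n) ∑_p h_p sin (π (2k-1) p / n)` of the canonical basis,
`k = 1, …, n/2`. -/
noncomputable def eTilde (n k : ℕ) : PlanarComplex n :=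
  ofCoord fun p => 2 / (n : ℝ) * Real.sin (Real.pi * (2 * (k : ℝ) - 1) * (p : ℕ) / n)

/-- The rotated coordinate `ξ_k` of `u`, `k = 1, …, n/2`. -/
noncomputable def xi {n : ℕ} (k : ℕ) (u : PlanarComplex n) : ℝ :=
  ∑ p : Fin n, Real.sqrt (2 / n) * Real.cos (Real.pi * (2 * (k : ℝ) - 1) * (p : ℕ) / n) * u.coord p

/-- The rotated coordinate `η_k` of `u`, `k = 1, …, n/2`. -/
noncomputable def eta {n : ℕ} (k : ℕ) (u : PlanarComplex n) : ℝ :=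
  ∑ p : Fin n, Real.sqrt (2 / n) * Real.sin (Real.pi * (2 * (k : ℝ) - 1) * (p : ℕ) / n) * u.coord p

/-- The projection of `u` on the `(ξ_k, η_k)` plane, this plane being identified with `ℂ` through
`ξ_k + i η_k`. -/
noncomputable def proj {n : ℕ} (k : ℕ) (u : PlanarComplex n) : ℂ := ⟨xi k u, eta k u⟩

/-- `z` is an interior point of the closed plane curve with trace `C`: it is not on the curve, and
the connected component of the complement of the curve that contains `z` is bounded.
(The points that are neither on `C` nor interior are the exterior ones.) -/
def IsInteriorPoint (z : ℂ) (C : Set ℂ) : Prop :=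
  z ∉ C ∧ Bornology.IsBounded (connectedComponentIn Cᶜ z)

open Classical in
/-- The functional `int(z, C)`: `1` if `z` is an interior point of `C`, and `0` if it is exterior. -/
noncomputable def interiorIndicator (z : ℂ) (C : Set ℂ) : ℝ := if IsInteriorPoint z C then 1 else 0

/-- Along `c`, the azimuthal angle about `z` increases in total by `2π`: `c` goes around `z` exactly
once, counterclockwise. -/
def WindsOnceAround (c : unitInterval → ℂ) (z : ℂ) : Prop :=
  ∃ φ : C(unitInterval, ℝ),
    (∀ t, c t - z = (‖c t - z‖ : ℂ) * Complex.exp ((φ t : ℂ) * Complex.I)) ∧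
      φ 1 - φ 0 = 2 * Real.pi

/-- A closed plane curve is counterclockwise if, in each bounded component of its complement, there
is a point around which it goes exactly once, counterclockwise. For a simple closed curve, which
has exactly one such component, this is positive orientation; a curve without interior points
(a constant one, or a segment that is run through to and fro) is included. -/
def IsCounterclockwise (c : unitInterval → ℂ) : Prop :=
  ∀ z, IsInteriorPoint z (Set.range c) →
    ∃ w ∈ connectedComponentIn (Set.range c)ᶜ z, WindsOnceAround c w

/-- The projection of the loop `Γ` on the `(ξ_k, η_k)` plane, with its parametrization. -/
noncomputable def projLoop {n : ℕ} {a : PlanarComplex n} (k : ℕ) (Γ : Path a a) :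
    unitInterval → ℂ := fun t => proj k (Γ t)

/-- `int(u_{0 ξ_k η_k}, Γ_{ξ_k η_k})`. -/
noncomputable def intProj {n : ℕ} {a : PlanarComplex n} (k : ℕ) (u₀ : PlanarComplex n)
    (Γ : Path a a) : ℝ := interiorIndicator (proj k u₀) (Set.range (projLoop k Γ))

/-- The loop is continuous, and continuously differentiable on each of the closed pieces of some
finite partition of `[0, 1]`. -/
def IsPiecewiseC1 {n : ℕ} {a : PlanarComplex n} (Γ : Path a a) : Prop :=
  ∃ (N : ℕ) (t : ℕ → ℝ), Monotone t ∧ t 0 = 0 ∧ t N = 1 ∧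
    ∀ i < N, ContDiffOn ℝ 1 Γ.extend (Set.Icc (t i) (t (i + 1)))

/-- The form `f(u) du`, that is `v ↦ f(u) v` at the point `u`. -/
noncomputable def form {n : ℕ} (f : PlanarComplex n → PlanarComplex n) :
    PlanarComplex n → PlanarComplex n →L[ℝ] PlanarComplex n :=
  fun u => LinearMap.toContinuousLinearMap (LinearMap.mulLeft ℝ (f u))

/-- `f(u) du` is integrable along `Γ`, and `∮_Γ f(u) du = I`. -/
def HasLoopIntegral {n : ℕ} {a : PlanarComplex n} (f : PlanarComplex n → PlanarComplex n)
    (Γ : Path a a) (I : PlanarComplex n) : Prop :=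
  CurveIntegrable (form f) Γ ∧ curveIntegral (form f) Γ = I

/-- Integer powers of an invertible `w`. -/
noncomputable def intPow {n : ℕ} (w : PlanarComplex n) : ℤ → PlanarComplex n
  | Int.ofNat m => w ^ m
  | Int.negSucc m => Ring.inverse w ^ (m + 1)

end PlanarComplex

/-!
With `ω = exp (iπ(2k-1)/n)`, a root of `ω ^ n = -1`, the map `χ_k : h_p ↦ ω ^ p` is a ring
homomorphism to `ℂ`; the `χ_k` with `1 ≤ k ≤ (n+1)/2` separate points, `χ_k u` is `√(n/2)` times the
projection of `u` on the `(ξ_k, η_k)` plane, and `χ_j ẽ_k = i δ_jk`. So every claim reduces to the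
Cauchy integrals `∫ dz / (z - w)` along the projections of `Γ`. As a function of `w` such an
integral is continuous off the curve with values in `2πi ℤ` and tends to zero at infinity. Hence it
is constant on each component of the complement and vanishes on the unbounded one, and it is `2πi`
on the bounded ones, as the curve winds once around some point of each. In a Laurent series, which
converges uniformly on the curve because `|w| ^ m ≤ |w₁| ^ m + |w₂| ^ m` when `|w₁| ≤ |w| ≤ |w₂|`,
only the term in `w⁻¹` contributes. For odd `n` the last character has the root `-1`: it is real
valued, so its Cauchy integrals vanish, and it kills every `ẽ_k`.
-/

section

open MeasureTheory Set Filter Topology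
open scoped unitInterval Real

theorem hasDerivAt_integral_right_of_mem_Ioo {E : Type*} [NormedAddCommGroup E] [NormedSpace ℝ E]
    [CompleteSpace E] {f : ℝ → E} {a b x : ℝ} (hf : IntervalIntegrable f volume a b)
    (hx : x ∈ Ioo a b) (hfx : ContinuousAt f x) :
    HasDerivAt (fun t => ∫ s in a..t, f s) (f x) x := by
  have hab : a ≤ b := (hx.1.trans hx.2).le
  refine intervalIntegral.integral_hasDerivAt_right (hf.mono_set ?_)
    ⟨Ioo a b, Ioo_mem_nhds hx.1 hx.2, ?_⟩ hfx
  · rw [uIcc_of_le hab, uIcc_of_le hx.1.le]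
    exact Icc_subset_Icc_right hx.2.le
  · exact ((intervalIntegrable_iff_integrableOn_Ioo_of_le hab).1 hf).aestronglyMeasurable

theorem hasSum_intervalIntegral_mul_of_tendstoUniformlyOn {ι 𝕜 : Type*} [RCLike 𝕜] {a b : ℝ}
    {w g : ℝ → 𝕜} {G : ι → ℝ → 𝕜} (hw : IntervalIntegrable w volume a b)
    (hG : ∀ l, ContinuousOn (G l) (uIcc a b))
    (hg : TendstoUniformlyOn (fun (s : Finset ι) t => ∑ l ∈ s, G l t) g atTop (uIcc a b)) :
    HasSum (fun l => ∫ t in a..b, G l t * w t) (∫ t in a..b, g t * w t) := by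
  have hsumc (s : Finset ι) : ContinuousOn (fun t => ∑ l ∈ s, G l t) (uIcc a b) :=
    continuousOn_finsetSum s fun l _ => hG l
  have hgc : ContinuousOn g (uIcc a b) := hg.continuousOn (Frequently.of_forall hsumc)
  set K := |∫ t in a..b, ‖w t‖|
  have hK : 0 < K + 1 := add_pos_of_nonneg_of_pos (abs_nonneg _) one_pos
  rw [HasSum, SummationFilter.unconditional_filter, Metric.tendsto_nhds]
  intro ε hε
  have hδ : 0 < ε / (K + 1) := div_pos hε hK
  filter_upwards [Metric.tendstoUniformlyOn_iff.1 hg _ hδ] with s hs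
  have hdiff : (∫ t in a..b, g t * w t) - ∑ l ∈ s, ∫ t in a..b, G l t * w t =
      ∫ t in a..b, (g t - ∑ l ∈ s, G l t) * w t := by
    rw [← intervalIntegral.integral_finsetSum fun l _ => hw.continuousOn_mul (hG l)]
    simp only [← Finset.sum_mul, sub_mul]
    exact (intervalIntegral.integral_sub (hw.continuousOn_mul hgc)
      (hw.continuousOn_mul (hsumc s))).symm
  have hle : ‖∫ t in a..b, (g t - ∑ l ∈ s, G l t) * w t‖ ≤ ε / (K + 1) * K := by
    have hbound : ∀ t ∈ uIoc a b, ‖(g t - ∑ l ∈ s, G l t) * w t‖ ≤ ε / (K + 1) * ‖w t‖ := by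
      intro t ht
      rw [norm_mul, ← dist_eq_norm]
      exact mul_le_mul_of_nonneg_right (hs t (uIoc_subset_uIcc ht)).le (norm_nonneg _)
    refine (intervalIntegral.norm_integral_le_abs_of_norm_le
      ((ae_restrict_mem measurableSet_uIoc).mono hbound) (hw.norm.const_mul _)).trans_eq ?_
    rw [intervalIntegral.integral_const_mul, abs_mul, abs_of_pos hδ]
  rw [dist_comm, dist_eq_norm, hdiff]
  refine hle.trans_lt ?_
  rw [div_mul_eq_mul_div, div_lt_iff₀ hK]
  linarith

theorem zpow_le_zpow_add_zpow {K : Type*} [Field K] [LinearOrder K] [IsStrictOrderedRing K]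
    {a x b : K} (ha : 0 < a) (hax : a ≤ x) (hxb : x ≤ b) (m : ℤ) : x ^ m ≤ a ^ m + b ^ m := by
  have hx : 0 < x := ha.trans_le hax
  have hb : 0 < b := hx.trans_le hxb
  rcases le_total 0 m with hm | hm
  · exact (zpow_le_zpow_left₀ hm hx.le hxb).trans (le_add_of_nonneg_left (zpow_pos ha m).le)
  · have hxm : x ^ m ≤ a ^ m := by
      simpa only [zpow_neg, inv_inv] using
        inv_anti₀ (zpow_pos ha (-m)) (zpow_le_zpow_left₀ (neg_nonneg.2 hm) ha.le hax)
    exact hxm.trans (le_add_of_nonneg_right (zpow_pos hb m).le)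

section Laurent

variable {X : Type*} [TopologicalSpace X] {K : Set X} {w G : X → ℂ} {b : ℤ → ℂ}

theorem tendstoUniformlyOn_sum_mul_zpow (hK : IsCompact K) (hw : ContinuousOn w K)
    (hw0 : ∀ x ∈ K, w x ≠ 0) (hG : ∀ x ∈ K, HasSum (fun m : ℤ => b m * w x ^ m) (G x)) :
    TendstoUniformlyOn (fun (s : Finset ℤ) x => ∑ m ∈ s, b m * w x ^ m) G atTop K := by
  rcases K.eq_empty_or_nonempty with rfl | hne
  · exact tendstoUniformlyOn_empty
  obtain ⟨x₀, hx₀, hmin⟩ := hK.exists_isMinOn hne hw.norm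
  obtain ⟨x₁, hx₁, hmax⟩ := hK.exists_isMaxOn hne hw.norm
  have hle (m : ℤ) (x) (hx : x ∈ K) :
      ‖b m * w x ^ m‖ ≤ ‖b m * w x₀ ^ m‖ + ‖b m * w x₁ ^ m‖ := by
    simp only [norm_mul, norm_zpow, ← mul_add]
    exact mul_le_mul_of_nonneg_left
      (zpow_le_zpow_add_zpow (norm_pos_iff.2 (hw0 x₀ hx₀)) (hmin hx) (hmax hx) m) (norm_nonneg _)
  exact (tendstoUniformlyOn_tsum ((hG x₀ hx₀).summable.norm.add (hG x₁ hx₁).summable.norm)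
    hle).congr_right fun x hx => (hG x hx).tsum_eq

theorem continuousOn_const_mul_zpow (hw : ContinuousOn w K) (hw0 : ∀ x ∈ K, w x ≠ 0) (c : ℂ)
    (m : ℤ) : ContinuousOn (fun x => c * w x ^ m) K :=
  continuousOn_const.mul (hw.zpow₀ m fun x hx => Or.inl (hw0 x hx))

theorem continuousOn_of_hasSum_mul_zpow (hK : IsCompact K) (hw : ContinuousOn w K)
    (hw0 : ∀ x ∈ K, w x ≠ 0) (hG : ∀ x ∈ K, HasSum (fun m : ℤ => b m * w x ^ m) (G x)) :
    ContinuousOn G K :=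
  (tendstoUniformlyOn_sum_mul_zpow hK hw hw0 hG).continuousOn <| Frequently.of_forall fun s =>
    continuousOn_finsetSum s fun m _ => continuousOn_const_mul_zpow hw hw0 (b m) m

end Laurent

/-- A parametrized curve `γ` on `[0, 1]` with velocity `γ'`: off a countable set, `γ` is
differentiable with derivative `γ'` continuous there, and `γ'` is integrable. The velocity is a
parameter because both one-sided derivatives at the corners are legitimate choices. -/
structure IsPiecewiseC1Curve {E : Type*} [NormedAddCommGroup E] [NormedSpace ℝ E]
    (γ γ' : ℝ → E) : Prop where
  continuousOn : ContinuousOn γ I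
  intervalIntegrable : IntervalIntegrable γ' volume 0 1
  exists_hasDerivAt : ∃ S : Set ℝ, S.Countable ∧
    ∀ t ∈ Ioo (0 : ℝ) 1 \ S, HasDerivAt γ (γ' t) t ∧ ContinuousAt γ' t

/-- The integral of `dw / (w - z)` along the plane curve `γ` with velocity `γ'`. -/
noncomputable def cauchyIntegral (γ γ' : ℝ → ℂ) (z : ℂ) : ℂ :=
  ∫ t in (0 : ℝ)..1, γ' t / (γ t - z)

theorem cauchyIntegral_const_mul {c : ℂ} (hc : c ≠ 0) (γ γ' : ℝ → ℂ) (z : ℂ) :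
    cauchyIntegral (fun t => c * γ t) (fun t => c * γ' t) (c * z) = cauchyIntegral γ γ' z := by
  simp only [cauchyIntegral, ← mul_sub, mul_div_mul_left _ _ hc]

namespace IsPiecewiseC1Curve

section

variable {E F : Type*} [NormedAddCommGroup E] [NormedSpace ℝ E] [NormedAddCommGroup F]
  [NormedSpace ℝ F]

theorem of_contDiffOn_Icc {γ : ℝ → E} {N : ℕ} {t : ℕ → ℝ} (hγ : ContinuousOn γ I)
    (ht : Monotone t) (h0 : t 0 = 0) (hN : t N = 1)
    (hC : ∀ i < N, ContDiffOn ℝ 1 γ (Icc (t i) (t (i + 1)))) :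
    IsPiecewiseC1Curve γ (derivWithin γ I) := by
  have hsub {i} (hi : i < N) : Ioo (t i) (t (i + 1)) ⊆ Ioo 0 1 :=
    Ioo_subset_Ioo (h0 ▸ ht (Nat.zero_le i)) (hN ▸ ht hi)
  have hderiv {i} (hi : i < N) {x} (hx : x ∈ Ioo (t i) (t (i + 1))) :
      derivWithin γ I x = derivWithin γ (Icc (t i) (t (i + 1))) x := by
    rw [derivWithin_of_mem_nhds (Icc_mem_nhds hx.1 hx.2),
      derivWithin_of_mem_nhds (Icc_mem_nhds (hsub hi hx).1 (hsub hi hx).2)]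
  have hcont {i} (hi : i < N) (hlt : t i < t (i + 1)) :
      ContinuousOn (derivWithin γ (Icc (t i) (t (i + 1)))) (Icc (t i) (t (i + 1))) :=
    (hC i hi).continuousOn_derivWithin (uniqueDiffOn_Icc hlt) le_rfl
  refine ⟨hγ, ?_, range t, countable_range t, fun x hx => ?_⟩
  · rw [← h0, ← hN]
    refine IntervalIntegrable.trans_iterate fun i hi => ?_
    rcases (ht i.le_succ).eq_or_lt with heq | hlt
    · simp only [← heq, IntervalIntegrable.refl]
    have hint := (hcont hi hlt).intervalIntegrable_of_Icc (μ := volume) hlt.le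
    rw [intervalIntegrable_iff_integrableOn_Ioo_of_le hlt.le] at hint ⊢
    exact hint.congr_fun (fun x hx => (hderiv hi hx).symm) measurableSet_Ioo
  · obtain ⟨i, hi, hxi⟩ : ∃ i < N, x ∈ Ioo (t i) (t (i + 1)) := by
      obtain ⟨i, hi, hxi⟩ := mem_iUnion₂.1 <| Ico_subset_biUnion_Ico N t
        ⟨(h0.trans_lt hx.1.1).le, hx.1.2.trans_eq hN.symm⟩
      exact ⟨i, Finset.mem_range.1 hi, hxi.1.lt_of_ne fun heq => hx.2 ⟨i, heq⟩, hxi.2⟩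
    have hnhds : Icc (t i) (t (i + 1)) ∈ 𝓝 x := Icc_mem_nhds hxi.1 hxi.2
    have heq : derivWithin γ I =ᶠ[𝓝 x] derivWithin γ (Icc (t i) (t (i + 1))) := by
      filter_upwards [isOpen_Ioo.mem_nhds hxi] with y hy using hderiv hi hy
    refine ⟨?_, (((hcont hi (hxi.1.trans hxi.2)).continuousAt hnhds).congr heq.symm)⟩
    rw [hderiv hi hxi]
    exact (((hC i hi).differentiableOn one_ne_zero x
      ⟨hxi.1.le, hxi.2.le⟩).hasDerivWithinAt).hasDerivAt hnhds

theorem clm_comp {γ γ' : ℝ → E} (h : IsPiecewiseC1Curve γ γ') (L : E →L[ℝ] F) :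
    IsPiecewiseC1Curve (fun t => L (γ t)) fun t => L (γ' t) := by
  obtain ⟨S, hS, hderiv⟩ := h.exists_hasDerivAt
  exact ⟨L.continuous.comp_continuousOn h.continuousOn,
    ⟨L.integrable_comp h.intervalIntegrable.1, L.integrable_comp h.intervalIntegrable.2⟩, S, hS,
    fun t ht => ⟨L.hasFDerivAt.comp_hasDerivAt t (hderiv t ht).1,
      L.continuous.continuousAt.comp (hderiv t ht).2⟩⟩

end

section

variable {𝕜 : Type*} [RCLike 𝕜] {γ γ' : ℝ → 𝕜}

theorem intervalIntegrable_mul (h : IsPiecewiseC1Curve γ γ') {G : ℝ → 𝕜}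
    (hG : ContinuousOn G I) : IntervalIntegrable (fun t => G t * γ' t) volume 0 1 :=
  h.intervalIntegrable.continuousOn_mul (by rwa [uIcc_of_le zero_le_one])

theorem hasSum_integral_mul_of_tendstoUniformlyOn (h : IsPiecewiseC1Curve γ γ') {ι : Type*}
    {G : ι → ℝ → 𝕜} {g : ℝ → 𝕜} (hG : ∀ l, ContinuousOn (G l) I)
    (hg : TendstoUniformlyOn (fun (s : Finset ι) t => ∑ l ∈ s, G l t) g atTop I) :
    HasSum (fun l => ∫ t in (0 : ℝ)..1, G l t * γ' t) (∫ t in (0 : ℝ)..1, g t * γ' t) :=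
  hasSum_intervalIntegral_mul_of_tendstoUniformlyOn h.intervalIntegrable
    (by rwa [uIcc_of_le zero_le_one]) (by rwa [uIcc_of_le zero_le_one])

theorem integral_comp_mul (h : IsPiecewiseC1Curve γ γ') {f f' : 𝕜 → 𝕜}
    (hf : ∀ z ∈ γ '' I, HasDerivAt f (f' z) z) (hf' : ContinuousOn f' (γ '' I)) :
    ∫ t in (0 : ℝ)..1, f' (γ t) * γ' t = f (γ 1) - f (γ 0) := by
  obtain ⟨S, hS, hderiv⟩ := h.exists_hasDerivAt
  have hfc : ContinuousOn f (γ '' I) := fun z hz => (hf z hz).continuousAt.continuousWithinAt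
  refine integral_eq_of_hasDerivAt_off_countable_of_le (fun t => f (γ t)) _ zero_le_one hS
    (hfc.comp h.continuousOn (mapsTo_image γ I)) (fun t ht => ?_)
    (h.intervalIntegrable_mul (hf'.comp h.continuousOn (mapsTo_image γ I)))
  have hγt : γ t ∈ γ '' I := mem_image_of_mem γ (Ioo_subset_Icc_self ht.1)
  rw [mul_comm]
  exact (hf _ hγt).scomp t (hderiv t ht).1

end

theorem cauchyIntegral_ofReal_eq_zero {γ γ' : ℝ → ℝ} (h : IsPiecewiseC1Curve γ γ')
    (hcl : γ 0 = γ 1) {x : ℝ} (hx : x ∉ γ '' I) :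
    cauchyIntegral (fun t => γ t) (fun t => γ' t) x = 0 := by
  have hne {y} (hy : y ∈ γ '' I) : y - x ≠ 0 := sub_ne_zero.2 fun heq => hx (heq ▸ hy)
  have hlog : ∫ t in (0 : ℝ)..1, (γ t - x)⁻¹ * γ' t = 0 := by
    rw [h.integral_comp_mul (f := fun y => Real.log (y - x)) (f' := fun y => (y - x)⁻¹), hcl,
      sub_self]
    · exact fun y hy => by simpa using ((hasDerivAt_id y).sub_const x).log (hne hy)
    · exact (continuousOn_id.sub continuousOn_const).inv₀ fun y hy => hne hy
  have hcast : cauchyIntegral (fun t => γ t) (fun t => γ' t) x =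
      (∫ t in (0 : ℝ)..1, (γ t - x)⁻¹ * γ' t : ℝ) := by
    rw [← intervalIntegral.integral_ofReal, cauchyIntegral]
    simp only [Complex.ofReal_mul, Complex.ofReal_inv, Complex.ofReal_sub, div_eq_inv_mul]
  rw [hcast, hlog, Complex.ofReal_zero]

variable {γ γ' : ℝ → ℂ}

theorem sub_ne_zero_of_notMem_image {z : ℂ} (hz : z ∉ γ '' I) {t : ℝ} (ht : t ∈ I) :
    γ t - z ≠ 0 :=
  sub_ne_zero.2 fun heq => hz ⟨t, ht, heq⟩

theorem continuousOn_sub (h : IsPiecewiseC1Curve γ γ') (z : ℂ) :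
    ContinuousOn (fun t => γ t - z) I :=
  h.continuousOn.sub continuousOn_const

theorem intervalIntegrable_div (h : IsPiecewiseC1Curve γ γ') {z : ℂ} (hz : z ∉ γ '' I) :
    IntervalIntegrable (fun t => γ' t / (γ t - z)) volume 0 1 := by
  simp only [div_eq_inv_mul]
  exact h.intervalIntegrable_mul
    ((h.continuousOn_sub z).inv₀ fun t ht => sub_ne_zero_of_notMem_image hz ht)

theorem continuousOn_primitive (h : IsPiecewiseC1Curve γ γ') {z : ℂ} (hz : z ∉ γ '' I) :
    ContinuousOn (fun t => ∫ s in (0 : ℝ)..t, γ' s / (γ s - z)) I := by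
  simpa only [uIcc_of_le zero_le_one] using
    intervalIntegral.continuousOn_primitive_interval' (h.intervalIntegrable_div hz) left_mem_uIcc

theorem exp_primitive (h : IsPiecewiseC1Curve γ γ') {z : ℂ} (hz : z ∉ γ '' I) {t : ℝ}
    (ht : t ∈ I) :
    Complex.exp (∫ s in (0 : ℝ)..t, γ' s / (γ s - z)) = (γ t - z) / (γ 0 - z) := by
  obtain ⟨S, hS, hderiv⟩ := h.exists_hasDerivAt
  set P : ℝ → ℂ := fun t => ∫ s in (0 : ℝ)..t, γ' s / (γ s - z)
  have hne {x} (hx : x ∈ I) : γ x - z ≠ 0 := sub_ne_zero_of_notMem_image hz hx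
  have hcont : ContinuousOn (fun x => (γ x - z) * Complex.exp (-P x)) (Icc 0 t) :=
    ((h.continuousOn_sub z).mul (h.continuousOn_primitive hz).neg.cexp).mono
      (Icc_subset_Icc_right ht.2)
  have hzero : ∀ x ∈ Ioo 0 t \ S, HasDerivAt (fun x => (γ x - z) * Complex.exp (-P x)) 0 x := by
    intro x hx
    have hxI : x ∈ Ioo (0 : ℝ) 1 := ⟨hx.1.1, hx.1.2.trans_le ht.2⟩
    have hxne := hne (Ioo_subset_Icc_self hxI)
    obtain ⟨hγ, hγ'⟩ := hderiv x ⟨hxI, hx.2⟩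
    have hPx : HasDerivAt P (γ' x / (γ x - z)) x :=
      hasDerivAt_integral_right_of_mem_Ioo (h.intervalIntegrable_div hz) hxI
        (hγ'.div (hγ.continuousAt.sub continuousAt_const) hxne)
    refine ((hγ.sub_const z).mul hPx.neg.cexp).congr_deriv ?_
    field_simp
    ring
  have hconst := integral_eq_of_hasDerivAt_off_countable_of_le _ (fun _ => (0 : ℂ)) ht.1 hS hcont
    hzero intervalIntegrable_const
  have hP0 : P 0 = 0 := intervalIntegral.integral_same
  rw [intervalIntegral.integral_zero, hP0, neg_zero, Complex.exp_zero, mul_one, eq_comm,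
    sub_eq_zero, Complex.exp_neg, mul_inv_eq_iff_eq_mul₀ (Complex.exp_ne_zero _)] at hconst
  rw [eq_div_iff (hne (left_mem_Icc.2 zero_le_one)), hconst, mul_comm]

theorem exp_cauchyIntegral (h : IsPiecewiseC1Curve γ γ') (hcl : γ 0 = γ 1) {z : ℂ}
    (hz : z ∉ γ '' I) : Complex.exp (cauchyIntegral γ γ' z) = 1 := by
  have hone : (1 : ℝ) ∈ I := right_mem_Icc.2 zero_le_one
  rw [cauchyIntegral, h.exp_primitive hz hone, hcl, div_self (sub_ne_zero_of_notMem_image hz hone)]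

theorem cauchyIntegral_eq_sub_of_exp_eq (h : IsPiecewiseC1Curve γ γ') {z : ℂ} (hz : z ∉ γ '' I)
    {L : I → ℂ} (hL : Continuous L) (hexp : ∀ t : I, Complex.exp (L t) = γ t - z) :
    cauchyIntegral γ γ' z = L 1 - L 0 := by
  set P : I → ℂ := fun t => ∫ s in (0 : ℝ)..t, γ' s / (γ s - z)
  have hPc : Continuous P :=
    (h.continuousOn_primitive hz).comp_continuous continuous_subtype_val Subtype.prop
  have hconst (t : I) : Complex.exp (P t - L t) = (γ 0 - z)⁻¹ := by
    rw [Complex.exp_sub, h.exp_primitive hz t.2, hexp, div_div_cancel_left']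
    exact sub_ne_zero_of_notMem_image hz t.2
  have hends : P 1 - L 1 = P 0 - L 0 :=
    Complex.isCoveringMap_exp.constOn_of_comp isPreconnected_univ (hPc.sub hL).continuousOn
      (fun s _ t _ => Subtype.ext ((hconst s).trans (hconst t).symm)) (mem_univ 1) (mem_univ 0)
  have hP0 : P 0 = 0 := intervalIntegral.integral_same
  have hP1 : P 1 = cauchyIntegral γ γ' z := rfl
  linear_combination hends + hP0 - hP1

theorem cauchyIntegral_of_windsOnceAround (h : IsPiecewiseC1Curve γ γ') (hcl : γ 0 = γ 1) {z : ℂ}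
    (hz : z ∉ γ '' I) (hw : PlanarComplex.WindsOnceAround (fun t => γ t) z) :
    cauchyIntegral γ γ' z = 2 * π * Complex.I := by
  obtain ⟨φ, hφ, htotal⟩ := hw
  have hnorm (t : I) : ‖γ t - z‖ ≠ 0 := norm_ne_zero_iff.2 (sub_ne_zero_of_notMem_image hz t.2)
  have hL : Continuous fun t : I => (Real.log ‖γ t - z‖ : ℂ) + φ t * Complex.I :=
    (Complex.continuous_ofReal.comp (((h.continuousOn_sub z).comp_continuous
      continuous_subtype_val Subtype.prop).norm.log hnorm)).add
      ((Complex.continuous_ofReal.comp φ.continuous).mul continuous_const)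
  have hexp (t : I) : Complex.exp ((Real.log ‖γ t - z‖ : ℂ) + φ t * Complex.I) = γ t - z := by
    rw [Complex.exp_add, ← Complex.ofReal_exp, Real.exp_log ((norm_nonneg _).lt_of_ne' (hnorm t))]
    exact (hφ t).symm
  rw [h.cauchyIntegral_eq_sub_of_exp_eq hz hL hexp, Icc.coe_zero, Icc.coe_one, hcl,
    add_sub_add_left_eq_sub, ← sub_mul, ← Complex.ofReal_sub, htotal]
  push_cast
  rfl

theorem norm_cauchyIntegral_le (h : IsPiecewiseC1Curve γ γ') {z : ℂ} {d : ℝ} (hd : 0 < d)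
    (hle : ∀ t ∈ I, d ≤ ‖γ t - z‖) :
    ‖cauchyIntegral γ γ' z‖ ≤ (∫ t in (0 : ℝ)..1, ‖γ' t‖) / d := by
  rw [cauchyIntegral, ← intervalIntegral.integral_div]
  refine intervalIntegral.norm_integral_le_of_norm_le zero_le_one
    (Eventually.of_forall fun t ht => ?_) (h.intervalIntegrable.norm.div_const d)
  rw [norm_div]
  exact div_le_div_of_nonneg_left (norm_nonneg _) hd (hle t (Ioc_subset_Icc_self ht))

theorem isCompact_image (h : IsPiecewiseC1Curve γ γ') : IsCompact (γ '' I) :=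
  isCompact_Icc.image_of_continuousOn h.continuousOn

theorem continuousAt_cauchyIntegral (h : IsPiecewiseC1Curve γ γ') {z : ℂ} (hz : z ∉ γ '' I) :
    ContinuousAt (cauchyIntegral γ γ') z := by
  have hne : (γ '' I).Nonempty := (nonempty_Icc.2 zero_le_one).image γ
  set d := Metric.infDist z (γ '' I) / 2
  have hd0 : 0 < d := half_pos ((h.isCompact_image.isClosed.notMem_iff_infDist_pos hne).1 hz)
  have hfar : ∀ᶠ w in 𝓝 z, ∀ t ∈ I, d ≤ ‖γ t - w‖ := by
    filter_upwards [Metric.ball_mem_nhds z hd0] with w hw t ht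
    have hzt : 2 * d ≤ dist z (γ t) :=
      (mul_div_cancel₀ _ two_ne_zero).trans_le (Metric.infDist_le_dist_of_mem ⟨t, ht, rfl⟩)
    rw [← dist_eq_norm, dist_comm]
    linarith [dist_triangle z w (γ t), Metric.mem_ball'.1 hw]
  refine intervalIntegral.continuousAt_of_dominated_interval
    (bound := fun t => ‖γ' t‖ / d) ?_ ?_ (h.intervalIntegrable.norm.div_const d) ?_
  · filter_upwards [h.isCompact_image.isClosed.isOpen_compl.mem_nhds hz] with w hw
    exact (h.intervalIntegrable_div hw).def'.aestronglyMeasurable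
  · filter_upwards [hfar] with w hw
    refine Eventually.of_forall fun t ht => ?_
    rw [uIoc_of_le zero_le_one] at ht
    rw [norm_div]
    exact div_le_div_of_nonneg_left (norm_nonneg _) hd0 (hw t (Ioc_subset_Icc_self ht))
  · refine Eventually.of_forall fun t ht => ?_
    rw [uIoc_of_le zero_le_one] at ht
    exact continuousAt_const.div (continuousAt_const.sub continuousAt_id)
      (sub_ne_zero_of_notMem_image hz (Ioc_subset_Icc_self ht))

theorem cauchyIntegral_eq_of_mem_component (h : IsPiecewiseC1Curve γ γ') (hcl : γ 0 = γ 1)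
    {z w : ℂ} (hz : z ∉ γ '' I) (hw : w ∈ connectedComponentIn (γ '' I)ᶜ z) :
    cauchyIntegral γ γ' w = cauchyIntegral γ γ' z := by
  have hoff {x} (hx : x ∈ connectedComponentIn (γ '' I)ᶜ z) : x ∉ γ '' I :=
    connectedComponentIn_subset _ _ hx
  refine Complex.isCoveringMap_exp.constOn_of_comp isPreconnected_connectedComponentIn
    (fun x hx => (h.continuousAt_cauchyIntegral (hoff hx)).continuousWithinAt)
    (fun x hx y hy => Subtype.ext ?_) hw (mem_connectedComponentIn hz)
  exact (h.exp_cauchyIntegral hcl (hoff hx)).trans (h.exp_cauchyIntegral hcl (hoff hy)).symm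

theorem cauchyIntegral_eq_zero_of_not_isBounded (h : IsPiecewiseC1Curve γ γ') (hcl : γ 0 = γ 1)
    {z : ℂ} (hz : z ∉ γ '' I) (hb : ¬ Bornology.IsBounded (connectedComponentIn (γ '' I)ᶜ z)) :
    cauchyIntegral γ γ' z = 0 := by
  obtain ⟨R, hR⟩ := isCompact_Icc.exists_bound_of_continuousOn h.continuousOn
  have hle {d : ℝ} (hd : 0 < d) :
      ‖cauchyIntegral γ γ' z‖ ≤ (∫ t in (0 : ℝ)..1, ‖γ' t‖) / d := by
    obtain ⟨w, hw, hwR⟩ : ∃ w ∈ connectedComponentIn (γ '' I)ᶜ z, R + d < ‖w‖ := by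
      by_contra! hbdd
      exact hb (isBounded_iff_forall_norm_le.2 ⟨_, hbdd⟩)
    rw [← h.cauchyIntegral_eq_of_mem_component hcl hz hw]
    refine h.norm_cauchyIntegral_le hd fun t ht => ?_
    rw [norm_sub_rev]
    linarith [hR t ht, norm_sub_norm_le w (γ t)]
  have hlim : Tendsto (fun d : ℝ => (∫ t in (0 : ℝ)..1, ‖γ' t‖) / d) atTop (𝓝 0) :=
    tendsto_const_nhds.div_atTop tendsto_id
  refine norm_le_zero_iff.1 (ge_of_tendsto hlim ?_)
  filter_upwards [eventually_gt_atTop 0] with d hd using hle hd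

theorem cauchyIntegral_eq_interiorIndicator (h : IsPiecewiseC1Curve γ γ') (hcl : γ 0 = γ 1)
    (hc : PlanarComplex.IsCounterclockwise fun t => γ t) {z : ℂ} (hz : z ∉ γ '' I) :
    cauchyIntegral γ γ' z = 2 * π * Complex.I *
      PlanarComplex.interiorIndicator z (range fun t : I => γ t) := by
  unfold PlanarComplex.IsCounterclockwise at hc
  rw [← image_eq_range] at hc ⊢
  by_cases hi : PlanarComplex.IsInteriorPoint z (γ '' I)
  · obtain ⟨w, hw, hwind⟩ := hc z hi
    rw [← h.cauchyIntegral_eq_of_mem_component hcl hz hw, h.cauchyIntegral_of_windsOnceAround hcl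
      (connectedComponentIn_subset _ _ hw) hwind]
    simp [PlanarComplex.interiorIndicator, hi]
  · rw [h.cauchyIntegral_eq_zero_of_not_isBounded hcl hz fun hb => hi ⟨hz, hb⟩]
    simp [PlanarComplex.interiorIndicator, hi]

theorem integral_zpow_mul_eq_zero (h : IsPiecewiseC1Curve γ γ') (hcl : γ 0 = γ 1) {z : ℂ}
    (hz : z ∉ γ '' I) {m : ℤ} (hm : m ≠ -1) :
    ∫ t in (0 : ℝ)..1, (γ t - z) ^ m * γ' t = 0 := by
  have hm1 : ((m + 1 : ℤ) : ℂ) ≠ 0 :=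
    Int.cast_ne_zero.2 fun h0 => hm (eq_neg_of_add_eq_zero_left h0)
  have hne {w} (hw : w ∈ γ '' I) : w - z ≠ 0 := sub_ne_zero.2 fun heq => hz (heq ▸ hw)
  rw [h.integral_comp_mul (f := fun w => (w - z) ^ (m + 1) / (m + 1 : ℤ))
    (f' := fun w => (w - z) ^ m), hcl, sub_self]
  · intro w hw
    have hpow := ((hasDerivAt_zpow (m + 1) (w - z) (Or.inl (hne hw))).comp w
      ((hasDerivAt_id' w).sub_const z)).div_const ((m + 1 : ℤ) : ℂ)
    rwa [add_sub_cancel_right, mul_one, mul_div_cancel_left₀ _ hm1] at hpow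
  · exact (continuousOn_id.sub continuousOn_const).zpow₀ m fun w hw => Or.inl (hne hw)

theorem integral_mul_of_hasSum_mul_zpow (h : IsPiecewiseC1Curve γ γ') (hcl : γ 0 = γ 1)
    {z : ℂ} (hz : z ∉ γ '' I) {b : ℤ → ℂ} {G : ℝ → ℂ}
    (hG : ∀ t ∈ I, HasSum (fun m : ℤ => b m * (γ t - z) ^ m) (G t)) :
    ∫ t in (0 : ℝ)..1, G t * γ' t = b (-1) * cauchyIntegral γ γ' z := by
  have hne : ∀ t ∈ I, γ t - z ≠ 0 := fun t ht => sub_ne_zero_of_notMem_image hz ht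
  have hterm (m : ℤ) := continuousOn_const_mul_zpow (h.continuousOn_sub z) hne (b m) m
  have hunif := tendstoUniformlyOn_sum_mul_zpow isCompact_Icc (h.continuousOn_sub z) hne hG
  have hsum := h.hasSum_integral_mul_of_tendstoUniformlyOn hterm hunif
  simp only [mul_assoc, intervalIntegral.integral_const_mul] at hsum
  rw [hsum.unique (hasSum_single (-1) fun m hm => by
    rw [h.integral_zpow_mul_eq_zero hcl hz hm, mul_zero]), cauchyIntegral]
  simp only [zpow_neg_one, div_eq_inv_mul]

end IsPiecewiseC1Curve
namespace PlanarComplex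

theorem sum_structureConst_smul_pow {n : ℕ} [NeZero n] {B : Type*} [Ring B] [Algebra ℝ B] {ζ : B}
    (hζ : ζ ^ n = -1) (a : ℕ) : ∑ q : Fin n, structureConst n a q • ζ ^ (q : ℕ) = ζ ^ a := by
  rw [Finset.sum_eq_single (⟨a % n, Nat.mod_lt _ (NeZero.pos n)⟩ : Fin n)]
  · conv_rhs => rw [← Nat.div_add_mod a n, pow_add, pow_mul, hζ]
    rw [structureConst, if_pos rfl, Algebra.smul_def, map_pow, map_neg, map_one]
  · intro q _ hq
    have hne : ¬ a % n = q := fun h => hq (Fin.ext h.symm)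
    rw [structureConst, if_neg hne, zero_smul]
  · simp

/-- The homomorphism `∑ x_p h_p ↦ ∑ x_p ζ ^ p` attached to an `n`-th root `ζ` of `-1`: since
`h_1 ^ n = -1`, the planar `n`-complex numbers are `ℝ[X] / (X ^ n + 1)`, with `h_p = h_1 ^ p`. -/
noncomputable def lift {n : ℕ} [NeZero n] {B : Type*} [Ring B] [Algebra ℝ B] (ζ : B)
    (hζ : ζ ^ n = -1) : PlanarComplex n →ₐ[ℝ] B :=
  AlgHom.ofLinearMap
    { toFun := fun u => ∑ p : Fin n, u.coord p • ζ ^ (p : ℕ)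
      map_add' := fun u v => by simp only [coord_add, add_smul, Finset.sum_add_distrib]
      map_smul' := fun r u => by
        simp only [coord_smul, mul_smul, ← Finset.smul_sum, RingHom.id_apply] }
    (by
      change ∑ p : Fin n, (1 : PlanarComplex n).coord p • ζ ^ (p : ℕ) = 1
      rw [Finset.sum_eq_single (0 : Fin n)]
      · simp [coord_one]
      · intro p _ hp
        have hp0 : (p : ℕ) ≠ 0 := fun h => hp (Fin.ext h)
        rw [coord_one, if_neg hp0, zero_smul]
      · simp)
    (fun u v => by
      change ∑ q : Fin n, (u * v).coord q • ζ ^ (q : ℕ) =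
        (∑ p : Fin n, u.coord p • ζ ^ (p : ℕ)) * ∑ p : Fin n, v.coord p • ζ ^ (p : ℕ)
      rw [Finset.sum_mul_sum]
      simp only [coord_mul, Finset.sum_smul]
      rw [Finset.sum_comm]
      refine Finset.sum_congr rfl fun i _ => ?_
      rw [Finset.sum_comm]
      refine Finset.sum_congr rfl fun j _ => ?_
      rw [smul_mul_smul_comm, ← pow_add, ← sum_structureConst_smul_pow hζ, Finset.smul_sum]
      exact Finset.sum_congr rfl fun q _ => by rw [mul_comm, mul_smul])

/-- The `k`-th root `ω_k = exp (iπ(2k - 1) / n)` of the equation `ω ^ n = -1`. -/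
noncomputable def rootNegOne (n k : ℕ) : ℂ :=
  Complex.exp ((π * (2 * (k : ℝ) - 1) / n : ℝ) * Complex.I)

section Roots

variable (n k : ℕ)

theorem rootNegOne_pow (p : ℕ) : rootNegOne n k ^ p =
    Complex.exp ((π * (2 * (k : ℝ) - 1) * p / n : ℝ) * Complex.I) := by
  rw [rootNegOne, ← Complex.exp_nat_mul]
  congr 1
  push_cast
  ring

theorem rootNegOne_ne_zero : rootNegOne n k ≠ 0 := Complex.exp_ne_zero _

theorem conj_rootNegOne : starRingEnd ℂ (rootNegOne n k) = (rootNegOne n k)⁻¹ := by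
  rw [rootNegOne, ← Complex.exp_conj, ← Complex.exp_neg, map_mul, Complex.conj_ofReal,
    Complex.conj_I, mul_neg]

variable [NeZero n]

theorem rootNegOne_eq_zpow :
    rootNegOne n k = Complex.exp (2 * π * Complex.I / (2 * n : ℕ)) ^ (2 * k - 1 : ℤ) := by
  have hn : (n : ℂ) ≠ 0 := Nat.cast_ne_zero.2 (NeZero.ne n)
  rw [rootNegOne, ← Complex.exp_int_mul]
  congr 1
  push_cast
  field_simp

theorem rootNegOne_pow_self : rootNegOne n k ^ n = -1 := by
  have hn : (n : ℂ) ≠ 0 := Nat.cast_ne_zero.2 (NeZero.ne n)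
  have hhalf : Complex.exp (2 * π * Complex.I / (2 * n : ℕ)) ^ n = -1 := by
    rw [← Complex.exp_nat_mul, ← Complex.exp_pi_mul_I]
    congr 1
    push_cast
    field_simp
  rw [rootNegOne_eq_zpow, ← zpow_natCast, zpow_comm, zpow_natCast, hhalf]
  exact Odd.neg_one_zpow ⟨k - 1, by ring⟩

variable {n k}

theorem rootNegOne_eq_iff {j : ℕ} : rootNegOne n j = rootNegOne n k ↔ j ≡ k [MOD n] := by
  have hprim := Complex.isPrimitiveRoot_exp (2 * n) (mul_ne_zero two_ne_zero (NeZero.ne n))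
  rw [Nat.ModEq.comm, Nat.modEq_iff_dvd, rootNegOne_eq_zpow, rootNegOne_eq_zpow, ← div_eq_one_iff_eq
    (zpow_ne_zero _ (Complex.exp_ne_zero _)), ← zpow_sub₀ (Complex.exp_ne_zero _),
    hprim.zpow_eq_one_iff_dvd, sub_sub_sub_cancel_right, ← mul_sub, Nat.cast_mul, Nat.cast_two,
    mul_dvd_mul_iff_left two_ne_zero]

theorem rootNegOne_mul_eq_one_iff {j : ℕ} :
    rootNegOne n j * rootNegOne n k = 1 ↔ j + k ≡ 1 [MOD n] := by
  have hprim := Complex.isPrimitiveRoot_exp (2 * n) (mul_ne_zero two_ne_zero (NeZero.ne n))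
  rw [Nat.ModEq.comm, Nat.modEq_iff_dvd, rootNegOne_eq_zpow, rootNegOne_eq_zpow,
    ← zpow_add₀ (Complex.exp_ne_zero _), hprim.zpow_eq_one_iff_dvd,
    show (2 * j - 1 + (2 * k - 1) : ℤ) = 2 * ((j + k : ℕ) - (1 : ℕ)) by push_cast; ring,
    Nat.cast_mul, Nat.cast_two, mul_dvd_mul_iff_left two_ne_zero]

theorem rootNegOne_injOn : InjOn (rootNegOne n) (Finset.Icc 1 n) := by
  intro j hj k hk hjk
  rw [Finset.mem_coe, Finset.mem_Icc] at hj hk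
  have hmod : j - 1 ≡ k - 1 [MOD n] :=
    Nat.ModEq.add_right_cancel' 1 (by
      rwa [Nat.sub_add_cancel hj.1, Nat.sub_add_cancel hk.1, ← rootNegOne_eq_iff])
  have := hmod.eq_of_lt_of_lt (by omega) (by omega)
  omega

theorem rootNegOne_mul_eq_one_iff_of_mem {j : ℕ} (hj : j ∈ Finset.Icc 1 n)
    (hk : k ∈ Finset.Icc 1 n) : rootNegOne n j * rootNegOne n k = 1 ↔ j + k = n + 1 := by
  rw [Finset.mem_Icc] at hj hk
  rw [rootNegOne_mul_eq_one_iff]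
  refine ⟨fun h => ?_, fun h => h ▸ Nat.add_modEq_left⟩
  have := Nat.eq_of_dvd_of_lt_two_mul (by omega) ((Nat.modEq_iff_dvd' (by omega)).1 h.symm)
    (by omega)
  omega

end Roots

theorem sum_fin_pow_eq_ite {n : ℕ} {ζ : ℂ} (hζ : ζ ^ n = 1) :
    ∑ p : Fin n, ζ ^ (p : ℕ) = if ζ = 1 then (n : ℂ) else 0 := by
  split_ifs with h
  · simp [h]
  · rw [Fin.sum_univ_eq_sum_range fun p => ζ ^ p, geom_sum_eq h, hζ, sub_self, zero_div]

section Char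

variable {n : ℕ} [NeZero n]

/-- The character `χ_k : u ↦ ∑ x_p ω_k ^ p` of the algebra of planar `n`-complex numbers. -/
noncomputable def char (n k : ℕ) [NeZero n] : PlanarComplex n →A[ℝ] ℂ :=
  ⟨lift (rootNegOne n k) (rootNegOne_pow_self n k), LinearMap.continuous_of_finiteDimensional _⟩

theorem char_apply (k : ℕ) (u : PlanarComplex n) :
    char n k u = ∑ p : Fin n, (u.coord p : ℂ) * rootNegOne n k ^ (p : ℕ) := rfl

theorem proj_eq (k : ℕ) (u : PlanarComplex n) : proj k u = √(2 / n) * char n k u := by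
  refine Complex.ext ?_ ?_
  · simp only [proj, xi, Complex.re_ofReal_mul, char_apply, Complex.re_sum, rootNegOne_pow,
      Complex.exp_ofReal_mul_I_re, Finset.mul_sum]
    exact Finset.sum_congr rfl fun p _ => by ring
  · simp only [proj, eta, Complex.im_ofReal_mul, char_apply, Complex.im_sum, rootNegOne_pow,
      Complex.exp_ofReal_mul_I_im, Finset.mul_sum]
    exact Finset.sum_congr rfl fun p _ => by ring

theorem char_eq_conj_char {j k : ℕ} (h : j + k = n + 1) (u : PlanarComplex n) :
    char n j u = starRingEnd ℂ (char n k u) := by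
  have hroot : rootNegOne n j = (rootNegOne n k)⁻¹ :=
    eq_inv_of_mul_eq_one_left (rootNegOne_mul_eq_one_iff.2 (h ▸ Nat.add_modEq_left))
  simp only [char_apply, map_sum, map_mul, map_pow, conj_rootNegOne, Complex.conj_ofReal, hroot]

theorem eq_zero_of_forall_char_eq_zero {u : PlanarComplex n}
    (hu : ∀ k ∈ Finset.Icc 1 ((n + 1) / 2), char n k u = 0) : u = 0 := by
  have hall (i : Fin n) : char n (i + 1) u = 0 := by
    by_cases hi : (i : ℕ) + 1 ≤ (n + 1) / 2
    · exact hu _ (Finset.mem_Icc.2 ⟨by omega, hi⟩)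
    · rw [char_eq_conj_char (k := n - i) (by omega),
        hu _ (Finset.mem_Icc.2 ⟨by omega, by omega⟩), map_zero]
  have hinj : Function.Injective fun i : Fin n => rootNegOne n (i + 1) := fun i j hij =>
    Fin.ext (Nat.succ_injective (rootNegOne_injOn (by simp) (by simp) hij))
  have hcoord := Matrix.eq_zero_of_forall_index_sum_pow_mul_eq_zero hinj
    (v := fun p : Fin n => (u.coord p : ℂ)) fun i => by
      simpa only [char_apply, mul_comm] using hall i
  exact ext_coord fun p => Complex.ofReal_eq_zero.1 (congrFun hcoord p)

theorem eq_of_forall_char_eq {u v : PlanarComplex n}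
    (h : ∀ k ∈ Finset.Icc 1 ((n + 1) / 2), char n k u = char n k v) : u = v :=
  sub_eq_zero.1 (eq_zero_of_forall_char_eq_zero fun k hk => by rw [map_sub, h k hk, sub_self])

theorem exists_leftInverse_char (n : ℕ) [NeZero n] :
    ∃ g : (Finset.Icc 1 ((n + 1) / 2) → ℂ) →L[ℝ] PlanarComplex n,
      ∀ u, g (fun k => char n k u) = u := by
  let f : PlanarComplex n →ₗ[ℝ] Finset.Icc 1 ((n + 1) / 2) → ℂ :=
    LinearMap.pi fun k => (char n k).toLinearMap
  obtain ⟨g, hg⟩ := f.exists_leftInverse_of_injective <| LinearMap.ker_eq_bot'.2 fun u hu =>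
    eq_zero_of_forall_char_eq_zero fun k hk => congrFun hu ⟨k, hk⟩
  exact ⟨g.toContinuousLinearMap, LinearMap.congr_fun hg⟩

theorem hasSum_of_char {ι : Type*} {r : ι → PlanarComplex n} {s : PlanarComplex n}
    (h : ∀ k ∈ Finset.Icc 1 ((n + 1) / 2), HasSum (fun l => char n k (r l)) (char n k s)) :
    HasSum r s := by
  obtain ⟨g, hg⟩ := exists_leftInverse_char n
  have hpi : HasSum (fun l (k : Finset.Icc 1 ((n + 1) / 2)) => char n k (r l))
      (fun k => char n k s) := Pi.hasSum.2 fun k => h k k.2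
  simpa only [hg] using! hpi.mapL g

theorem continuousOn_of_char {X : Type*} [TopologicalSpace X] {K : Set X}
    {v : X → PlanarComplex n}
    (h : ∀ k ∈ Finset.Icc 1 ((n + 1) / 2), ContinuousOn (fun x => char n k (v x)) K) :
    ContinuousOn v K := by
  obtain ⟨g, hg⟩ := exists_leftInverse_char n
  simpa only [Function.comp_def, hg] using
    g.continuous.comp_continuousOn (continuousOn_pi.2 fun k => h k.1 k.2)

theorem intervalIntegrable_of_char {v : ℝ → PlanarComplex n} {x y : ℝ}
    (h : ∀ k ∈ Finset.Icc 1 ((n + 1) / 2),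
      IntervalIntegrable (fun t => char n k (v t)) volume x y) :
    IntervalIntegrable v volume x y := by
  obtain ⟨g, hg⟩ := exists_leftInverse_char n
  have hleft := g.integrable_comp (Integrable.of_eval fun k => (h k.1 k.2).1)
  have hright := g.integrable_comp (Integrable.of_eval fun k => (h k.1 k.2).2)
  simp only [hg] at hleft hright
  exact ⟨hleft, hright⟩

theorem char_eTilde {j k : ℕ} (hj : j ∈ Finset.Icc 1 n) (hk : k ∈ Finset.Icc 1 n) :
    char n j (eTilde n k) =
      Complex.I * ((if j = k then 1 else 0) - if j + k = n + 1 then 1 else 0) := by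
  have hn : (n : ℂ) ≠ 0 := Nat.cast_ne_zero.2 (NeZero.ne n)
  have hpow (i : ℕ) : rootNegOne n i ^ n = -1 := rootNegOne_pow_self n i
  have hterm (p : Fin n) : ((eTilde n k).coord p : ℂ) * rootNegOne n j ^ (p : ℕ) =
      Complex.I / n * ((rootNegOne n j * (rootNegOne n k)⁻¹) ^ (p : ℕ) -
        (rootNegOne n j * rootNegOne n k) ^ (p : ℕ)) := by
    rw [eTilde, coord_ofCoord, Complex.ofReal_mul, Complex.ofReal_sin, Complex.sin, neg_mul,
      Complex.exp_neg, ← rootNegOne_pow, mul_pow, mul_pow, inv_pow]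
    push_cast
    ring
  simp only [char_apply, hterm, ← Finset.mul_sum, Finset.sum_sub_distrib]
  rw [sum_fin_pow_eq_ite (by rw [mul_pow, inv_pow, hpow, hpow]; norm_num),
    sum_fin_pow_eq_ite (by rw [mul_pow, hpow, hpow]; norm_num)]
  simp only [mul_inv_eq_one₀ (rootNegOne_ne_zero n k), rootNegOne_injOn.eq_iff hj hk,
    rootNegOne_mul_eq_one_iff_of_mem hj hk]
  split_ifs <;> field_simp <;> ring

theorem char_inverse (k : ℕ) {w : PlanarComplex n} (hw : IsUnit w) :
    char n k (Ring.inverse w) = (char n k w)⁻¹ :=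
  eq_inv_of_mul_eq_one_left (by rw [← map_mul, Ring.inverse_mul_cancel w hw, map_one])

theorem char_intPow (k : ℕ) {w : PlanarComplex n} (hw : IsUnit w) (m : ℤ) :
    char n k (intPow w m) = char n k w ^ m := by
  cases m with
  | ofNat m => rw [intPow, map_pow, Int.ofNat_eq_natCast, zpow_natCast]
  | negSucc m => rw [intPow, map_pow, char_inverse k hw, zpow_negSucc, inv_pow]

end Char

section Powers

variable {n : ℕ} {w : PlanarComplex n}

theorem intPow_natCast_sub_one (hw : IsUnit w) (m : ℕ) :
    intPow w (m - 1) = w ^ m * Ring.inverse w := by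
  cases m with
  | zero => rw [pow_zero, one_mul, ← pow_one (Ring.inverse w)]; rfl
  | succ m =>
    rw [Nat.cast_succ, add_sub_cancel_right, pow_succ, mul_assoc, Ring.mul_inverse_cancel w hw,
      mul_one]
    rfl

theorem hasSum_mul_intPow_of_hasSum_mul_pow {c : ℕ → PlanarComplex n} {s : PlanarComplex n}
    (hw : IsUnit w) (h : HasSum (fun m => c m * w ^ m) s) :
    HasSum (fun m => Function.extend (fun i : ℕ => (i : ℤ) - 1) c 0 m * intPow w m)
      (s * Ring.inverse w) := by
  have hinj : Function.Injective fun i : ℕ => (i : ℤ) - 1 :=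
    sub_left_injective.comp Nat.cast_injective
  rw [← hinj.hasSum_iff fun m hm => by
    rw [Function.extend_apply' _ _ _ hm, Pi.zero_apply, zero_mul]]
  have hmul := (LinearMap.mulRight ℝ (Ring.inverse w)).toContinuousLinearMap.hasSum h
  convert! hmul using 1
  ext m
  rw [Function.comp_apply, hinj.extend_apply, intPow_natCast_sub_one hw, ← mul_assoc]
  rfl

end Powers

section Curve

variable {n : ℕ} {a : PlanarComplex n} {Γ : Path a a}

/-- The element `∑_k int(u_{0 ξ_k η_k}, Γ_{ξ_k η_k}) ẽ_k`, which takes the place that `i` times the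
winding number has in the residue theorem of the complex plane. -/
noncomputable def windingElement (Γ : Path a a) (u₀ : PlanarComplex n) : PlanarComplex n :=
  ∑ k ∈ Finset.Icc 1 (n / 2), intProj k u₀ Γ • eTilde n k

theorem IsPiecewiseC1.isPiecewiseC1Curve (hΓ : IsPiecewiseC1 Γ) :
    IsPiecewiseC1Curve Γ.extend (derivWithin Γ.extend I) := by
  obtain ⟨N, t, hmono, h0, hN, hC⟩ := hΓ
  exact .of_contDiffOn_Icc Γ.continuous_extend.continuousOn hmono h0 hN hC

theorem mapsTo_extend (Γ : Path a a) (s : Set ℝ) : MapsTo Γ.extend s (range Γ) :=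
  fun t _ => Γ.extend_range ▸ mem_range_self t

theorem form_apply (f : PlanarComplex n → PlanarComplex n) (u v : PlanarComplex n) :
    form f u v = f u * v := rfl

variable [NeZero n]

theorem char_windingElement {k : ℕ} (hk : k ∈ Finset.Icc 1 ((n + 1) / 2)) (Γ : Path a a)
    (u₀ : PlanarComplex n) : char n k (windingElement Γ u₀) =
      if k ∈ Finset.Icc 1 (n / 2) then Complex.I * intProj k u₀ Γ else 0 := by
  rw [Finset.mem_Icc] at hk
  rw [windingElement, map_sum,
    ← Finset.sum_ite_eq (b := fun j => Complex.I * (intProj j u₀ Γ : ℂ))]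
  refine Finset.sum_congr rfl fun j hj => ?_
  rw [Finset.mem_Icc] at hj
  rw [map_smul, char_eTilde (Finset.mem_Icc.2 ⟨hk.1, by omega⟩)
    (Finset.mem_Icc.2 ⟨hj.1, by omega⟩), if_neg (by omega : ¬ k + j = n + 1), sub_zero,
    Complex.real_smul]
  split_ifs with hkj
  · rw [mul_one, mul_comm]
  · rw [mul_zero, mul_zero]

theorem IsPiecewiseC1.isPiecewiseC1Curve_char (hΓ : IsPiecewiseC1 Γ) (k : ℕ) :
    IsPiecewiseC1Curve (fun t => char n k (Γ.extend t))
      fun t => char n k (derivWithin Γ.extend I t) :=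
  hΓ.isPiecewiseC1Curve.clm_comp (char n k).toContinuousLinearMap

theorem char_notMem_image {u₀ : PlanarComplex n} (hu : ∀ t, IsUnit (Γ t - u₀)) (k : ℕ) :
    char n k u₀ ∉ (fun t => char n k (Γ.extend t)) '' I := by
  rintro ⟨t, ht, heq⟩
  have hne := ((hu ⟨t, ht⟩).map (char n k)).ne_zero
  rw [map_sub, sub_ne_zero, ← Path.extend_apply Γ ht] at hne
  exact hne heq

theorem cauchyIntegral_char_of_isCounterclockwise (hΓ : IsPiecewiseC1 Γ) {k : ℕ}
    (hor : IsCounterclockwise (projLoop k Γ)) {u₀ : PlanarComplex n}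
    (hu : ∀ t, IsUnit (Γ t - u₀)) :
    cauchyIntegral (fun t => char n k (Γ.extend t))
      (fun t => char n k (derivWithin Γ.extend I t)) (char n k u₀) =
      2 * π * Complex.I * intProj k u₀ Γ := by
  have hs : (√(2 / n) : ℂ) ≠ 0 := by
    have hn : (0 : ℝ) < n := Nat.cast_pos.2 (NeZero.pos n)
    exact Complex.ofReal_ne_zero.2 (Real.sqrt_pos.2 (by positivity)).ne'
  have hproj : projLoop k Γ = fun t : I => √(2 / n) * char n k (Γ.extend t) := by
    ext t
    rw [projLoop, proj_eq, Path.extend_apply Γ t.2]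
  have hnotMem : proj k u₀ ∉ (fun t => √(2 / n) * char n k (Γ.extend t)) '' I := by
    rintro ⟨t, ht, heq⟩
    rw [proj_eq] at heq
    exact char_notMem_image hu k ⟨t, ht, mul_left_cancel₀ hs heq⟩
  rw [intProj, ← cauchyIntegral_const_mul hs, ← proj_eq, hproj]
  rw [hproj] at hor
  exact ((hΓ.isPiecewiseC1Curve_char k).clm_comp
    (ContinuousLinearMap.mul ℝ ℂ (√(2 / n) : ℂ))).cauchyIntegral_eq_interiorIndicator
      (by simp) hor hnotMem

theorem cauchyIntegral_char_of_add_self (hΓ : IsPiecewiseC1 Γ) {k : ℕ} (hk : k + k = n + 1)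
    {u₀ : PlanarComplex n} (hu : ∀ t, IsUnit (Γ t - u₀)) :
    cauchyIntegral (fun t => char n k (Γ.extend t))
      (fun t => char n k (derivWithin Γ.extend I t)) (char n k u₀) = 0 := by
  have hreal (u : PlanarComplex n) : ((char n k u).re : ℂ) = char n k u :=
    Complex.conj_eq_iff_re.1 (char_eq_conj_char hk u).symm
  have hzero := ((hΓ.isPiecewiseC1Curve_char k).clm_comp
    Complex.reCLM).cauchyIntegral_ofReal_eq_zero (x := (char n k u₀).re) (by simp) <| by
      rintro ⟨t, ht, heq⟩
      refine char_notMem_image hu k ⟨t, ht, ?_⟩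
      exact (hreal _).symm.trans ((congrArg _ heq).trans (hreal u₀))
  simpa only [Complex.reCLM_apply, hreal] using hzero

theorem cauchyIntegral_char (hΓ : IsPiecewiseC1 Γ)
    (hor : ∀ k ∈ Finset.Icc 1 (n / 2), IsCounterclockwise (projLoop k Γ))
    {u₀ : PlanarComplex n} (hu : ∀ t, IsUnit (Γ t - u₀)) {k : ℕ}
    (hk : k ∈ Finset.Icc 1 ((n + 1) / 2)) :
    cauchyIntegral (fun t => char n k (Γ.extend t))
      (fun t => char n k (derivWithin Γ.extend I t)) (char n k u₀) =
      2 * π * char n k (windingElement Γ u₀) := by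
  rw [char_windingElement hk]
  split_ifs with hmem
  · rw [cauchyIntegral_char_of_isCounterclockwise hΓ (hor k hmem) hu, mul_assoc _ Complex.I]
  · rw [Finset.mem_Icc] at hk hmem
    rw [cauchyIntegral_char_of_add_self hΓ (by omega) hu, mul_zero]

theorem curveIntegrable_form (hΓ : IsPiecewiseC1 Γ) {f : PlanarComplex n → PlanarComplex n}
    (hf : ContinuousOn f (range Γ)) : CurveIntegrable (form f) Γ := by
  refine intervalIntegrable_of_char fun k _ => ?_
  have hcont : ContinuousOn (fun t => char n k (f (Γ.extend t))) I :=
    (char n k).cont.comp_continuousOn (hf.comp Γ.continuous_extend.continuousOn (mapsTo_extend Γ I))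
  simpa only [curveIntegralFun_def, form_apply, map_mul] using
    (hΓ.isPiecewiseC1Curve_char k).intervalIntegrable_mul hcont

theorem char_curveIntegral {f : PlanarComplex n → PlanarComplex n}
    (hf : CurveIntegrable (form f) Γ) (k : ℕ) :
    char n k (curveIntegral (form f) Γ) = ∫ t in (0 : ℝ)..1,
      char n k (f (Γ.extend t)) * char n k (derivWithin Γ.extend I t) := by
  have hcomm := (char n k).toContinuousLinearMap.intervalIntegral_comp_comm hf
  simpa only [curveIntegral_def, curveIntegralFun_def, form_apply,
    ContinuousAlgHom.coe_toContinuousLinearMap, map_mul] using hcomm.symm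

theorem hasSum_char_mul_zpow (k : ℕ) {b : ℤ → PlanarComplex n} {w s : PlanarComplex n}
    (hw : IsUnit w) (h : HasSum (fun m => b m * intPow w m) s) :
    HasSum (fun m => char n k (b m) * char n k w ^ m) (char n k s) := by
  simpa only [ContinuousAlgHom.coe_toContinuousLinearMap, map_mul, char_intPow k hw] using
    (char n k).toContinuousLinearMap.hasSum h

theorem continuousOn_of_hasSum_mul_intPow {K : Set (PlanarComplex n)} (hK : IsCompact K)
    {u₀ : PlanarComplex n} (hu : ∀ u ∈ K, IsUnit (u - u₀)) {b : ℤ → PlanarComplex n}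
    {F : PlanarComplex n → PlanarComplex n}
    (hF : ∀ u ∈ K, HasSum (fun m => b m * intPow (u - u₀) m) (F u)) : ContinuousOn F K :=
  continuousOn_of_char fun k _ => continuousOn_of_hasSum_mul_zpow hK
    ((char n k).cont.comp_continuousOn (continuousOn_id.sub continuousOn_const))
    (fun u hmem => ((hu u hmem).map (char n k)).ne_zero)
    fun u hmem => hasSum_char_mul_zpow k (hu u hmem) (hF u hmem)

theorem hasLoopIntegral_of_hasSum_mul_intPow (hΓ : IsPiecewiseC1 Γ)
    (hor : ∀ k ∈ Finset.Icc 1 (n / 2), IsCounterclockwise (projLoop k Γ)) {u₀ : PlanarComplex n}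
    (hu : ∀ t, IsUnit (Γ t - u₀)) {b : ℤ → PlanarComplex n}
    {F : PlanarComplex n → PlanarComplex n}
    (hF : ∀ u ∈ range Γ, HasSum (fun m => b m * intPow (u - u₀) m) (F u)) :
    HasLoopIntegral F Γ ((2 * π) • (windingElement Γ u₀ * b (-1))) := by
  have hint : CurveIntegrable (form F) Γ := curveIntegrable_form hΓ <|
    continuousOn_of_hasSum_mul_intPow (isCompact_range Γ.continuous) (forall_mem_range.2 hu) hF
  refine ⟨hint, eq_of_forall_char_eq fun k hk => ?_⟩
  have hG : ∀ t ∈ I, HasSum (fun m => char n k (b m) *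
      (char n k (Γ.extend t) - char n k u₀) ^ m) (char n k (F (Γ.extend t))) := by
    intro t ht
    rw [← map_sub, Path.extend_apply Γ ht]
    exact hasSum_char_mul_zpow k (hu _) (hF _ (mem_range_self _))
  have hlaurent := (hΓ.isPiecewiseC1Curve_char k).integral_mul_of_hasSum_mul_zpow (by simp)
    (char_notMem_image hu k) hG
  rw [char_curveIntegral hint, hlaurent, cauchyIntegral_char hΓ hor hu hk, map_smul, map_mul,
    Complex.real_smul]
  push_cast
  ring

theorem hasSum_curveIntegral_of_tendstoUniformlyOn (hΓ : IsPiecewiseC1 Γ) {ι : Type*}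
    {F : ι → PlanarComplex n → PlanarComplex n} {f : PlanarComplex n → PlanarComplex n}
    (hF : ∀ l, ContinuousOn (F l) (range Γ))
    (hf : TendstoUniformlyOn (fun (s : Finset ι) u => ∑ l ∈ s, F l u) f atTop (range Γ)) :
    HasSum (fun l => curveIntegral (form (F l)) Γ) (curveIntegral (form f) Γ) := by
  have hfc : ContinuousOn f (range Γ) :=
    hf.continuousOn (Frequently.of_forall fun s => continuousOn_finsetSum s fun l _ => hF l)
  refine hasSum_of_char fun k _ => ?_
  simp only [char_curveIntegral (curveIntegrable_form hΓ hfc),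
    fun l => char_curveIntegral (curveIntegrable_form hΓ (hF l))]
  refine (hΓ.isPiecewiseC1Curve_char k).hasSum_integral_mul_of_tendstoUniformlyOn
    (fun l => (char n k).cont.comp_continuousOn
      ((hF l).comp Γ.continuous_extend.continuousOn (mapsTo_extend Γ I))) ?_
  have hunif := (((char n k).toContinuousLinearMap.uniformContinuous.comp_tendstoUniformlyOn
    hf).comp Γ.extend).mono (mapsTo_extend Γ I)
  exact hunif.congr (Eventually.of_forall fun s t _ => map_sum (char n k) _ s)

theorem hasLoopIntegral_mul_inverse_sub (hΓ : IsPiecewiseC1 Γ)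
    (hor : ∀ k ∈ Finset.Icc 1 (n / 2), IsCounterclockwise (projLoop k Γ)) {u₀ : PlanarComplex n}
    (hu : ∀ t, IsUnit (Γ t - u₀)) {f : PlanarComplex n → PlanarComplex n}
    {c : ℕ → PlanarComplex n}
    (hf : ∀ u ∈ insert u₀ (range Γ), HasSum (fun m => c m * (u - u₀) ^ m) (f u)) :
    HasLoopIntegral (fun u => f u * Ring.inverse (u - u₀)) Γ
      ((2 * π) • (f u₀ * windingElement Γ u₀)) := by
  have hc : f u₀ = c 0 := by
    have hsingle := hasSum_single (f := fun m => c m * (u₀ - u₀) ^ m) 0 fun m hm => by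
      rw [sub_self, zero_pow hm, mul_zero]
    rw [(hf u₀ (mem_insert _ _)).unique hsingle, pow_zero, mul_one]
  have hres : Function.extend (fun i : ℕ => (i : ℤ) - 1) c 0 (-1) = c 0 :=
    (sub_left_injective.comp Nat.cast_injective).extend_apply c 0 0
  rw [hc, mul_comm (c 0), ← hres]
  exact hasLoopIntegral_of_hasSum_mul_intPow hΓ hor hu <| forall_mem_range.2 fun t =>
    hasSum_mul_intPow_of_hasSum_mul_pow (hu t) (hf _ (mem_insert_of_mem _ (mem_range_self t)))

theorem hasLoopIntegral_inverse_sub (hΓ : IsPiecewiseC1 Γ)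
    (hor : ∀ k ∈ Finset.Icc 1 (n / 2), IsCounterclockwise (projLoop k Γ)) {u₀ : PlanarComplex n}
    (hu : ∀ t, IsUnit (Γ t - u₀)) :
    HasLoopIntegral (fun u => Ring.inverse (u - u₀)) Γ ((2 * π) • windingElement Γ u₀) := by
  have hone (u : PlanarComplex n) : HasSum
      (fun m => (Pi.single 0 1 : ℕ → PlanarComplex n) m * (u - u₀) ^ m) 1 := by
    simpa only [Pi.single_eq_same, pow_zero, mul_one] using
      hasSum_single (f := fun m => (Pi.single 0 1 : ℕ → PlanarComplex n) m * (u - u₀) ^ m) 0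
        fun m hm => by rw [Pi.single_eq_of_ne hm, zero_mul]
  simpa only [one_mul] using hasLoopIntegral_mul_inverse_sub hΓ hor hu fun u _ => hone u

theorem hasLoopIntegral_of_tendstoUniformlyOn (hΓ : IsPiecewiseC1 Γ)
    (hor : ∀ k ∈ Finset.Icc 1 (n / 2), IsCounterclockwise (projLoop k Γ)) {ι : Type*}
    {p : ι → PlanarComplex n} {c : ι → ℤ → PlanarComplex n}
    {F : ι → PlanarComplex n → PlanarComplex n} {f : PlanarComplex n → PlanarComplex n}
    (hu : ∀ l t, IsUnit (Γ t - p l))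
    (hF : ∀ l, ∀ u ∈ range Γ, HasSum (fun m => c l m * intPow (u - p l) m) (F l u))
    (hf : TendstoUniformlyOn (fun (s : Finset ι) u => ∑ l ∈ s, F l u) f atTop (range Γ)) :
    ∃ J, HasLoopIntegral f Γ J ∧
      HasSum (fun l => (2 * π) • (windingElement Γ (p l) * c l (-1))) J := by
  have hFc (l : ι) : ContinuousOn (F l) (range Γ) := continuousOn_of_hasSum_mul_intPow
    (isCompact_range Γ.continuous) (forall_mem_range.2 (hu l)) (hF l)
  have hfc : ContinuousOn f (range Γ) :=
    hf.continuousOn (Frequently.of_forall fun s => continuousOn_finsetSum s fun l _ => hFc l)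
  refine ⟨_, ⟨curveIntegrable_form hΓ hfc, rfl⟩, ?_⟩
  simpa only [(hasLoopIntegral_of_hasSum_mul_intPow hΓ hor (hu _) (hF _)).2] using
    hasSum_curveIntegral_of_tendstoUniformlyOn hΓ hFc hf

end Curve

end PlanarComplex
end

theorem mainTheorem3_general (n : ℕ) (hpos : 0 < n)
    {a : PlanarComplex n} (Γ : Path a a) (hΓ : PlanarComplex.IsPiecewiseC1 Γ)
    (hor : ∀ k ∈ Finset.Icc 1 (n / 2),
      PlanarComplex.IsCounterclockwise (PlanarComplex.projLoop k Γ)) :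
    (∀ u₀ : PlanarComplex n, (∀ t, IsUnit (Γ t - u₀)) →
      PlanarComplex.HasLoopIntegral (fun u => Ring.inverse (u - u₀)) Γ
        (∑ k ∈ Finset.Icc 1 (n / 2),
          (2 * Real.pi * PlanarComplex.intProj k u₀ Γ) • PlanarComplex.eTilde n k)) ∧
    (∀ (u₀ : PlanarComplex n) (f : PlanarComplex n → PlanarComplex n) (c : ℕ → PlanarComplex n),
      (∀ t, IsUnit (Γ t - u₀)) →
      (∀ u ∈ insert u₀ (Set.range Γ), HasSum (fun m => c m * (u - u₀) ^ m) (f u)) →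
      PlanarComplex.HasLoopIntegral (fun u => f u * Ring.inverse (u - u₀)) Γ
        ((2 * Real.pi) • (f u₀ * ∑ k ∈ Finset.Icc 1 (n / 2),
          PlanarComplex.intProj k u₀ Γ • PlanarComplex.eTilde n k))) ∧
    (∀ (ι : Type*) (p : ι → PlanarComplex n) (c : ι → ℤ → PlanarComplex n)
      (F : ι → PlanarComplex n → PlanarComplex n) (f : PlanarComplex n → PlanarComplex n),
      (∀ l t, IsUnit (Γ t - p l)) →
      (∀ l, ∀ u ∈ Set.range Γ,
        HasSum (fun m : ℤ => c l m * PlanarComplex.intPow (u - p l) m) (F l u)) →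
      TendstoUniformlyOn (fun (s : Finset ι) u => ∑ l ∈ s, F l u) f Filter.atTop (Set.range Γ) →
      ∃ I : PlanarComplex n, PlanarComplex.HasLoopIntegral f Γ I ∧
        HasSum (fun l => (2 * Real.pi) • ((∑ k ∈ Finset.Icc 1 (n / 2),
          PlanarComplex.intProj k (p l) Γ • PlanarComplex.eTilde n k) * c l (-1))) I) := by
  have : NeZero n := ⟨hpos.ne'⟩
  refine ⟨fun u₀ hu => ?_, fun u₀ f c hu hf => ?_, fun ι p c F f hu hF hf => ?_⟩
  · have h := PlanarComplex.hasLoopIntegral_inverse_sub hΓ hor hu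
    simpa only [PlanarComplex.windingElement, Finset.smul_sum, smul_smul] using h
  · exact PlanarComplex.hasLoopIntegral_mul_inverse_sub hΓ hor hu hf
  · exact PlanarComplex.hasLoopIntegral_of_tendstoUniformlyOn hΓ hor hu hF hf

theorem mainTheorem3 (n : ℕ) (hn : Even n) (hpos : 0 < n)
    {a : PlanarComplex n} (Γ : Path a a) (hΓ : PlanarComplex.IsPiecewiseC1 Γ)
    (hor : ∀ k ∈ Finset.Icc 1 (n / 2),
      PlanarComplex.IsCounterclockwise (PlanarComplex.projLoop k Γ)) :
    (∀ u₀ : PlanarComplex n, (∀ t, IsUnit (Γ t - u₀)) →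
      PlanarComplex.HasLoopIntegral (fun u => Ring.inverse (u - u₀)) Γ
        (∑ k ∈ Finset.Icc 1 (n / 2),
          (2 * Real.pi * PlanarComplex.intProj k u₀ Γ) • PlanarComplex.eTilde n k)) ∧
    (∀ (u₀ : PlanarComplex n) (f : PlanarComplex n → PlanarComplex n) (c : ℕ → PlanarComplex n),
      (∀ t, IsUnit (Γ t - u₀)) →
      (∀ u ∈ insert u₀ (Set.range Γ), HasSum (fun m => c m * (u - u₀) ^ m) (f u)) →
      PlanarComplex.HasLoopIntegral (fun u => f u * Ring.inverse (u - u₀)) Γ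
        ((2 * Real.pi) • (f u₀ * ∑ k ∈ Finset.Icc 1 (n / 2),
          PlanarComplex.intProj k u₀ Γ • PlanarComplex.eTilde n k))) ∧
    (∀ (ι : Type*) (p : ι → PlanarComplex n) (c : ι → ℤ → PlanarComplex n)
      (F : ι → PlanarComplex n → PlanarComplex n) (f : PlanarComplex n → PlanarComplex n),
      (∀ l t, IsUnit (Γ t - p l)) →
      (∀ l, ∀ u ∈ Set.range Γ,
        HasSum (fun m : ℤ => c l m * PlanarComplex.intPow (u - p l) m) (F l u)) →
      TendstoUniformlyOn (fun (s : Finset ι) u => ∑ l ∈ s, F l u) f Filter.atTop (Set.range Γ) →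
      ∃ I : PlanarComplex n, PlanarComplex.HasLoopIntegral f Γ I ∧
        HasSum (fun l => (2 * Real.pi) • ((∑ k ∈ Finset.Icc 1 (n / 2),
          PlanarComplex.intProj k (p l) Γ • PlanarComplex.eTilde n k) * c l (-1))) I) :=
  mainTheorem3_general n hpos Γ hΓ hor
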